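/- Let $n\ge 0$ and let $\lambda=(\lambda_1\ge\lambda_2\ge\dots\ge\lambda_p>0)$ be a partition of $n$. Let $T_\lambda$ be the Young tableau obtained by writing $1,\dots,n$ into the Young diagram of $\lambda$ (rows of lengths $\lambda_1,\dots,\lambda_p$) in increasing order, left to right and top to bottom. Let $P_\lambda\subseteq S_n$ (respectively $Q_\lambda\subseteq S_n$) be the subgroup of permutations mapping every element of $\{1,\dots,n\}$ to an element standing in the same row (respectively column) of $T_\lambda$. In the group algebra $\mathbb C[S_n]$ put $$a_\lambda=\frac1{|P_\lambda|}\sum_{g\in P_\lambda}g,\qquad b_\lambda=\frac1{|Q_\lambda|}\sum_{g\in Q_\lambda}\operatorname{sgn}(g)\,g,\qquad c_\lambda=a_\lambda b_\lambda,$$ and let $V_\lambda=\mathbb C[S_n]c_\lambda$ be the Specht module, on which $S_n$ acts by left multiplication; let $\chi_{V_\lambda}$ be its character. For a sequence ${\bf i}=(i_1,i_2,\dots)$ of nonnegative integers with $\sum_m m\,i_m=n$, let $C_{\bf i}\subset S_n$ be the conjugacy class of the permutations having exactly $i_m$ cycles of length $m$ for every $m\ge1$ (fixed points being cycles of length $1$).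 **Theorem (Frobenius character formula).** Let $N\ge p$, let $x_1,\dots,x_N$ be variables, and put $$\Delta(x)=\prod_{1\le j<k\le N}(x_j-x_k),\qquad H_m(x)=\sum_{j=1}^N x_j^m ,$$ and $\lambda_j=0$ for $j>p$. Then $\chi_{V_\lambda}(C_{\bf i})$ is the coefficient of $x^{\lambda+\rho}:=\prod_{j=1}^N x_j^{\lambda_j+N-j}$ in the polynomial $$\Delta(x)\prod_{m\ge1}H_m(x)^{i_m}.$$ -/

import Mathlib

namespace FrobeniusFormula

open scoped BigOperators

/-- The parts `λ₁ ≥ λ₂ ≥ … ≥ λ_p > 0` of a partition of `n`, in decreasing order, as the blocks of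
a composition of `n`. -/
def orderedParts {n : ℕ} (lam : n.Partition) : Composition n where
  blocks := lam.parts.sort (· ≥ ·)
  blocks_pos := fun h => lam.parts_pos ((Multiset.mem_sort _).1 h)
  blocks_sum := by
    rw [← Multiset.sum_coe, Multiset.sort_eq, lam.parts_sum]

/-- The part `λ_{j+1}` (rows are numbered from `0`), with the convention that it is `0` beyond the
last part. -/
def part {n : ℕ} (lam : n.Partition) (j : ℕ) : ℕ :=
  (orderedParts lam).blocks.getD j 0

/-- The row of the entry `k` in the tableau `T_λ`, obtained by writing `0, …, n - 1` into the
Young diagram of `λ` in increasing order, left to right and top to bottom. -/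
def tableauRow {n : ℕ} (lam : n.Partition) (k : Fin n) : ℕ :=
  ((orderedParts lam).index k : ℕ)

/-- The column of the entry `k` in the tableau `T_λ`. -/
def tableauCol {n : ℕ} (lam : n.Partition) (k : Fin n) : ℕ :=
  ((orderedParts lam).invEmbedding k : ℕ)

/-- The subgroup of the permutations that map every element to an element with the same value
of `f`. -/
def fiberSubgroup {α β : Type*} (f : α → β) : Subgroup (Equiv.Perm α) where
  carrier := {g | ∀ k, f (g k) = f k}
  one_mem' := fun _ => rfl
  mul_mem' := fun {g h} hg hh k => by
    rw [Equiv.Perm.mul_apply, hg, hh]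
  inv_mem' := fun {g} hg k => by
    rw [← hg (g⁻¹ k), ← Equiv.Perm.mul_apply, mul_inv_cancel, Equiv.Perm.one_apply]

/-- The row subgroup `P_λ` of `S_n`. -/
def rowSubgroup {n : ℕ} (lam : n.Partition) : Subgroup (Equiv.Perm (Fin n)) :=
  fiberSubgroup (tableauRow lam)

/-- The column subgroup `Q_λ` of `S_n`. -/
def colSubgroup {n : ℕ} (lam : n.Partition) : Subgroup (Equiv.Perm (Fin n)) :=
  fiberSubgroup (tableauCol lam)

open Classical in
/-- The Young projector `a_λ = |P_λ|⁻¹ ∑_{g ∈ P_λ} g`. -/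
noncomputable def rowProjector {n : ℕ} (lam : n.Partition) :
    MonoidAlgebra ℂ (Equiv.Perm (Fin n)) :=
  (Nat.card (rowSubgroup lam) : ℂ)⁻¹ •
    ∑ g : rowSubgroup lam, MonoidAlgebra.of ℂ (Equiv.Perm (Fin n)) g

open Classical in
/-- The Young projector `b_λ = |Q_λ|⁻¹ ∑_{g ∈ Q_λ} (-1)^g g`. -/
noncomputable def colProjector {n : ℕ} (lam : n.Partition) :
    MonoidAlgebra ℂ (Equiv.Perm (Fin n)) :=
  (Nat.card (colSubgroup lam) : ℂ)⁻¹ •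
    ∑ g : colSubgroup lam, ((Equiv.Perm.sign (g : Equiv.Perm (Fin n)) : ℤ) : ℂ) •
      MonoidAlgebra.of ℂ (Equiv.Perm (Fin n)) g

/-- The element `c_λ = a_λ b_λ` of `ℂ[S_n]`. -/
noncomputable def youngSymmetrizer {n : ℕ} (lam : n.Partition) :
    MonoidAlgebra ℂ (Equiv.Perm (Fin n)) :=
  rowProjector lam * colProjector lam

/-- The Specht module `V_λ = ℂ[S_n] c_λ`, as a left ideal of `ℂ[S_n]`. -/
noncomputable def spechtModule {n : ℕ} (lam : n.Partition) :
    Submodule (MonoidAlgebra ℂ (Equiv.Perm (Fin n))) (MonoidAlgebra ℂ (Equiv.Perm (Fin n))) :=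
  Submodule.span (MonoidAlgebra ℂ (Equiv.Perm (Fin n))) {youngSymmetrizer lam}

/-- The representation of `S_n` on `V_λ` by left multiplication. -/
noncomputable def spechtRep {n : ℕ} (lam : n.Partition) :
    Representation ℂ (Equiv.Perm (Fin n)) (spechtModule lam) :=
  Representation.ofModule' (spechtModule lam)

/-- The polynomial `Δ(x) = ∏_{i < j} (x_i - x_j)` in the variables `x_1, …, x_N`. -/
noncomputable def deltaPoly (N : ℕ) : MvPolynomial (Fin N) ℂ :=
  ∏ i : Fin N, ∏ j ∈ Finset.Ioi i, (MvPolynomial.X i - MvPolynomial.X j)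

/-- The exponent `λ + ρ`, where `ρ = (N - 1, N - 2, …, 0)`. -/
noncomputable def shiftedExponent {n : ℕ} (lam : n.Partition) (N : ℕ) : Fin N →₀ ℕ :=
  Finsupp.equivFunOnFinite.symm fun j => part lam j + (N - 1 - (j : ℕ))

end FrobeniusFormula

/-!
The Specht character `χ` and the class function `θ` given by the coefficients of `x^(λ+ρ)` are real,
so it suffices that both have norm one and that their inner product is one: then the sum of the
squares of `χ - θ` over the group is zero.

Expanding `Δ` as an alternating sum and reading `∏ H_m(x)^{i_m}` as the enumerator of the words
`Fin n → Fin N` fixed by a permutation (`prod_psum_pow`) writes `θ` as the alternating sum over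
`σ ∈ S_N` of the permutation characters on words of content `λ + ρ - σρ` (`alternantChar`).

* The norm of `θ` (`sum_alternantChar_mul_self`): pairing `θ` with a permutation character of
  content `α` gives the coefficient of `x^(λ+ρ)` in `Δ h_α`, by counting orbits of pairs of words. The
  alternating sum of the `h_α` is the Jacobi–Trudi determinant, whose product with `Δ` is the
  alternant `det(x_l^{(λ+ρ)_j})` (`deltaPoly_mul_det`).
* The norm of `χ` (`sum_character_mul_self`): since `a_λ y b_λ` is always a multiple of `c_λ`, the
  element `c_λ` acts on `V_λ` with rank one and `c_λ² = κ c_λ`. Computing the trace of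
  `v ↦ g v c_λ` on the group algebra gives `κ χ(g) = ∑_y c_λ(y⁻¹ g⁻¹ y)`, and the norm follows.
* The inner product (`sum_alternantChar_mul_character`): the stabilizer of a word of content
  `λ + ρ - σρ` kills `V_λ` unless `σ = 1`, and the normalized stabilizer sum of a word of content
  `λ` acts on `V_λ` as a projection of rank one.

Both statements about the group algebra rest on one inequality (`sum_tableauRow_le`): among the
fillings of the diagram with distinct entries in each column, the one by row numbers has the least
sum, and equality forces every column to be filled by its own row numbers. For `σ ≠ 1` the content
`λ + ρ - σρ` has a strictly smaller sum, by the rearrangement inequality.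
-/

namespace FrobeniusFormula

open Equiv.Perm MvPolynomial

/-! ### Words and their contents -/

/-- The content of a word `w` of length `n` in the alphabet `ι`: the multiplicity of each letter. -/
noncomputable def content {n : ℕ} {ι : Type*} (w : Fin n → ι) : ι →₀ ℕ :=
  ∑ k, Finsupp.single (w k) 1

theorem content_apply {n : ℕ} {ι : Type*} [DecidableEq ι] (w : Fin n → ι) (j : ι) :
    content w j = (Finset.univ.filter fun k => w k = j).card := by
  rw [content, Finsupp.finsetSum_apply, Finset.card_filter]
  simp only [Finsupp.single_apply]

theorem content_comp_perm {n : ℕ} {ι : Type*} (w : Fin n → ι) (h : Equiv.Perm (Fin n)) :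
    content (w ∘ h) = content w :=
  Equiv.sum_comp h fun k => Finsupp.single (w k) 1

theorem sum_content_mul {n : ℕ} {ι : Type*} [Fintype ι] (w : Fin n → ι) (f : ι → ℕ) :
    ∑ j, content w j * f j = ∑ k, f (w k) := by
  classical
  simp only [content, Finsupp.finsetSum_apply, Finset.sum_mul]
  rw [Finset.sum_comm]
  simp [Finsupp.single_apply]

theorem exists_perm_of_content_eq {n : ℕ} {ι : Type*} {w z : Fin n → ι}
    (h : content w = content z) : ∃ e : Equiv.Perm (Fin n), z ∘ e = w := by
  classical
  have hc : ∀ j, Nonempty ({k // w k = j} ≃ {k // z k = j}) := fun j => by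
    refine ⟨Fintype.equivOfCardEq ?_⟩
    rw [Fintype.card_subtype, Fintype.card_subtype]
    simpa only [content_apply] using congrArg (fun c => c j) h
  exact ⟨Equiv.ofFiberEquiv fun j => (hc j).some,
    funext fun k => Equiv.ofFiberEquiv_map (fun j => (hc j).some) k⟩

/-- Every exponent of degree `n` is the content of a word of length `n`. -/
theorem exists_content_eq {n : ℕ} {ι : Type*} [Fintype ι] (c : ι →₀ ℕ) (hc : ∑ j, c j = n) :
    ∃ w : Fin n → ι, content w = c := by
  classical
  have e : (Σ j, Fin (c j)) ≃ Fin n := Fintype.equivFinOfCardEq (by simp [hc])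
  refine ⟨fun k => (e.symm k).1, Finsupp.ext fun j => ?_⟩
  rw [content, Finsupp.finsetSum_apply,
    Equiv.sum_comp e.symm fun s : Σ j, Fin (c j) => Finsupp.single s.1 1 j, Fintype.sum_sigma]
  simp [Finsupp.single_apply]

/-- The number of permutations of the positions that fix the word `w`. -/
noncomputable def stabCard {n : ℕ} {ι : Type*} [DecidableEq ι] (w : Fin n → ι) : ℕ :=
  (Finset.univ.filter fun g : Equiv.Perm (Fin n) => w ∘ g = w).card

theorem stabCard_comp_perm {n : ℕ} {ι : Type*} [DecidableEq ι] (w : Fin n → ι)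
    (e : Equiv.Perm (Fin n)) : stabCard (w ∘ e) = stabCard w := by
  refine Finset.card_bij' (fun g _ => e * g * e⁻¹) (fun g _ => e⁻¹ * g * e) ?_ ?_ ?_ ?_
  · intro g hg
    have hg := (Finset.mem_filter.1 hg).2
    refine Finset.mem_filter.2 ⟨Finset.mem_univ _, funext fun k => ?_⟩
    simpa using congrFun hg (e⁻¹ k)
  · intro g hg
    have hg := (Finset.mem_filter.1 hg).2
    refine Finset.mem_filter.2 ⟨Finset.mem_univ _, funext fun k => ?_⟩
    simpa using congrFun hg (e k)
  all_goals intro g _; simp [mul_assoc]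

/-- Orbit–stabilizer for the action of `S_n` on words: the words in the orbit of `z` are those
with the content of `z`, and each is hit by a coset of the stabilizer. -/
theorem sum_comp_perm {n : ℕ} {ι M : Type*} [Fintype ι] [DecidableEq ι] [AddCommMonoid M]
    (z : Fin n → ι) (f : (Fin n → ι) → M) :
    ∑ h : Equiv.Perm (Fin n), f (z ∘ h) =
      stabCard z • ∑ w with content w = content z, f w := by
  classical
  rw [← Finset.sum_fiberwise_of_maps_to (s := Finset.univ)
    (t := Finset.univ.filter fun w => content w = content z)
    (g := fun h : Equiv.Perm (Fin n) => z ∘ h)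
    (fun h _ => by simp [content_comp_perm]), Finset.smul_sum]
  refine Finset.sum_congr rfl fun w hw => ?_
  obtain ⟨e, rfl⟩ := exists_perm_of_content_eq (Finset.mem_filter.1 hw).2
  rw [Finset.sum_congr rfl fun h hh => congrArg f (Finset.mem_filter.1 hh).2, Finset.sum_const]
  congr 1
  refine Finset.card_bij' (fun h _ => h * e⁻¹) (fun g _ => g * e) ?_ ?_ ?_ ?_
  · intro h hh
    have := (Finset.mem_filter.1 hh).2
    simp only [Finset.mem_filter, Finset.mem_univ, true_and]
    ext k
    simpa using congrFun this (e⁻¹ k)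
  · intro g hg
    have := (Finset.mem_filter.1 hg).2
    simp only [Finset.mem_filter, Finset.mem_univ, true_and]
    ext k
    simpa using congrFun this (e k)
  · simp
  · simp

/-- Summed over an orbit of words, the stabilizer orders add up to `n!`. -/
theorem sum_stabCard {n : ℕ} {ι : Type*} [Fintype ι] [DecidableEq ι] (c : ι →₀ ℕ)
    (hc : ∑ j, c j = n) :
    ∑ w : Fin n → ι with content w = c, stabCard w = n.factorial := by
  obtain ⟨z, rfl⟩ := exists_content_eq c hc
  have key : n.factorial =
      stabCard z * (Finset.univ.filter fun w : Fin n → ι => content w = content z).card := by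
    simpa [Fintype.card_perm] using sum_comp_perm z fun _ => (1 : ℕ)
  have : ∀ w ∈ Finset.univ.filter fun w : Fin n → ι => content w = content z,
      stabCard w = stabCard z := by
    intro w hw
    obtain ⟨e, rfl⟩ := exists_perm_of_content_eq (Finset.mem_filter.1 hw).2
    exact stabCard_comp_perm z e
  rw [Finset.sum_congr rfl this, Finset.sum_const, smul_eq_mul, mul_comm, ← key]

/-! ### Power sums count fixed words -/

/-- The parts of the cycle type, fixed points included, are the sizes of the cycles, seen as the
classes of the relation of lying in the same cycle. -/
theorem prod_sameCycle_quotient {α M : Type*} [Fintype α] [DecidableEq α] [CommMonoid M]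
    (g : Equiv.Perm α) [Fintype (Quotient (SameCycle.setoid g))]
    [DecidableEq (Quotient (SameCycle.setoid g))] (φ : ℕ → M) :
    ∏ q : Quotient (SameCycle.setoid g),
      φ (Finset.univ.filter fun x => Quotient.mk (SameCycle.setoid g) x = q).card =
      (g.partition.parts.map φ).prod := by
  classical
  have hmk : ∀ x y, Quotient.mk (SameCycle.setoid g) x = Quotient.mk _ y ↔ SameCycle g x y :=
    fun x y => Quotient.eq (r := SameCycle.setoid g)
  let C : Quotient (SameCycle.setoid g) → Equiv.Perm α :=
    Quotient.lift (fun x => g.cycleOf x) fun x y h => SameCycle.cycleOf_eq h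
  have hC : ∀ x, C (Quotient.mk _ x) = g.cycleOf x := fun x => rfl
  rw [← Finset.prod_filter_mul_prod_filter_not Finset.univ (fun q => C q ≠ 1),
    parts_partition, Multiset.map_add, Multiset.prod_add, Multiset.map_replicate,
    Multiset.prod_replicate, cycleType_def, Multiset.map_map]
  congr 1
  · change _ = ∏ c ∈ g.cycleFactorsFinset, φ (c.support.card)
    refine Finset.prod_bij (fun q _ => C q) ?_ ?_ ?_ ?_
    · intro q hq
      induction q using Quotient.inductionOn with | _ x =>
      simpa [hC, cycleOf_mem_cycleFactorsFinset_iff, cycleOf_eq_one_iff] using hq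
    · intro q hq r hr h
      induction q using Quotient.inductionOn with | _ x =>
      induction r using Quotient.inductionOn with | _ y =>
      rw [hmk]
      have hx : g x ≠ x := by simpa [hC, cycleOf_eq_one_iff] using hq
      have : x ∈ (g.cycleOf y).support := by
        rw [← hC, ← h, hC]; simpa using hx
      exact (mem_support_cycleOf_iff.1 this).1.symm
    · intro c hc
      obtain ⟨x, hx⟩ := (mem_cycleFactorsFinset_iff.1 hc).1.nonempty_support
      have h := (cycle_is_cycleOf hx hc)
      refine ⟨Quotient.mk _ x, ?_, h.symm⟩
      simp only [Finset.mem_filter, Finset.mem_univ, true_and, hC, ← h]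
      exact (mem_cycleFactorsFinset_iff.1 hc).1.ne_one
    · intro q hq
      induction q using Quotient.inductionOn with | _ x =>
      have hx : g x ≠ x := by simpa [hC, cycleOf_eq_one_iff] using hq
      rw [hC]
      congr 2
      ext y
      rw [mem_support_cycleOf_iff]
      simp only [Finset.mem_filter, Finset.mem_univ, true_and, hmk, mem_support]
      exact ⟨fun h => ⟨h.symm, hx⟩, fun h => h.1.symm⟩
  · have h1 : ∀ q ∈ Finset.univ.filter fun q => ¬ C q ≠ 1,
        φ (Finset.univ.filter fun x => Quotient.mk (SameCycle.setoid g) x = q).card = φ 1 := by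
      intro q hq
      induction q using Quotient.inductionOn with | _ x =>
      have hx : g x = x := by simpa [hC, cycleOf_eq_one_iff] using hq
      congr 1
      rw [Finset.card_eq_one]
      refine ⟨x, ?_⟩
      ext y
      simp only [Finset.mem_filter, Finset.mem_univ, true_and, hmk, Finset.mem_singleton]
      exact ⟨fun h => (h.symm.eq_of_left hx).symm, fun h => h ▸ SameCycle.refl _ _⟩
    rw [Finset.prod_congr rfl h1, Finset.prod_const]
    congr 1
    rw [← Finset.card_compl]
    symm
    refine Finset.card_bij (fun x _ => Quotient.mk _ x) ?_ ?_ ?_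
    · intro x hx
      simpa [hC, cycleOf_eq_one_iff] using hx
    · intro x hx y _ h
      have hx : g x = x := by simpa using hx
      exact ((hmk _ _).1 h).eq_of_left hx
    · intro q hq
      induction q using Quotient.inductionOn with | _ x =>
      exact ⟨x, by simpa [hC, cycleOf_eq_one_iff] using hq, rfl⟩

/-- The product of power sums attached to a permutation enumerates, by content, the words that
the permutation fixes: such a word is a choice of one letter for each cycle. -/
theorem prod_psum_parts {n N : ℕ} (g : Equiv.Perm (Fin n)) :
    (g.partition.parts.map fun m => psum (Fin N) ℂ m).prod =
      ∑ w : Fin n → Fin N with w ∘ g = w, monomial (content w) 1 := by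
  classical
  have hmon : ∀ w : Fin n → Fin N, (monomial (content w) 1 : MvPolynomial (Fin N) ℂ) =
      ∏ k, X (w k) := by
    intro w
    simp only [content, X]
    exact monomial_sum_one _ _
  rw [← prod_sameCycle_quotient]
  simp only [psum]
  rw [Finset.prod_univ_sum]
  simp only [hmon, Fintype.piFinset_univ]
  have hmk : ∀ x y, Quotient.mk (SameCycle.setoid g) x = Quotient.mk _ y ↔ SameCycle g x y :=
    fun x y => Quotient.eq (r := SameCycle.setoid g)
  have hfix : ∀ w : Fin n → Fin N, w ∘ g = w → ∀ x y, SameCycle g x y → w x = w y := by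
    intro w hw x y hxy
    obtain ⟨m, rfl⟩ := hxy.exists_nat_pow_eq
    induction m with
    | zero => rfl
    | succ m ih =>
      rw [pow_succ', Equiv.Perm.mul_apply]
      exact (ih ⟨m, rfl⟩).trans (congrFun hw _).symm
  refine Finset.sum_bij' (fun f _ => fun k => f (Quotient.mk _ k))
    (fun w hw => Quotient.lift w (hfix w (Finset.mem_filter.1 hw).2)) ?_ ?_ ?_ ?_ ?_
  · intro f _
    simp only [Finset.mem_filter, Finset.mem_univ, true_and]
    ext k
    simp only [Function.comp]
    rw [(hmk _ _).2 (sameCycle_apply_left.2 (SameCycle.refl g k))]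
  · simp
  · intro f _
    funext q
    induction q using Quotient.inductionOn with | _ x => rfl
  · intro w _
    rfl
  · intro f _
    rw [← Finset.prod_fiberwise Finset.univ fun k => Quotient.mk (SameCycle.setoid g) k]
    refine Finset.prod_congr rfl fun q _ => ?_
    rw [← Finset.prod_const]
    exact Finset.prod_congr rfl fun k hk =>
      congrArg (fun q => X (f q)) (Finset.mem_filter.1 hk).2.symm

theorem prod_psum_pow {n N : ℕ} (i : ℕ → ℕ) (g : Equiv.Perm (Fin n))
    (hg : ∀ m : ℕ, 1 ≤ m → g.partition.parts.count m = i m) :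
    ∏ m ∈ Finset.Icc 1 n, psum (Fin N) ℂ m ^ i m =
      ∑ w : Fin n → Fin N with w ∘ g = w, monomial (content w) 1 := by
  rw [← prod_psum_parts, Finset.prod_multiset_map_count]
  rw [Finset.prod_congr rfl fun m hm => by rw [← hg m (Finset.mem_Icc.1 hm).1]]
  symm
  refine Finset.prod_subset (fun m hm => ?_) fun m _ hm => ?_
  · rw [Multiset.mem_toFinset] at hm
    exact Finset.mem_Icc.2 ⟨g.partition.parts_pos hm,
      (Nat.Partition.le_of_mem_parts hm).trans (Fintype.card_fin n).le⟩
  · rw [Multiset.mem_toFinset] at hm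
    rw [Multiset.count_eq_zero_of_notMem hm, pow_zero]

/-! ### The Jacobi–Trudi identity -/

/-- The complete homogeneous symmetric polynomial `h_d`: the sum of all monomials of degree `d`. -/
noncomputable def completeHomog (N d : ℕ) : MvPolynomial (Fin N) ℂ :=
  ∑ m ∈ Finset.finsuppAntidiag Finset.univ d, monomial m 1

/-- The matrix `(h_{α_j - (N - 1 - k)})_{j,k}`, where `h` vanishes at negative indices. -/
noncomputable def jacobiTrudiMatrix {N : ℕ} (α : Fin N → ℕ) :
    Matrix (Fin N) (Fin N) (MvPolynomial (Fin N) ℂ) :=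
  .of fun j k => if N - 1 - (k : ℕ) ≤ α j then completeHomog N (α j - (N - 1 - k)) else 0

theorem mk_pow_mul_one_sub {R : Type*} [CommRing R] (a : R) :
    PowerSeries.mk (fun k => a ^ k) * (1 - PowerSeries.C a * PowerSeries.X) = 1 := by
  ext k
  rw [mul_sub, mul_one, ← mul_assoc, map_sub, mul_comm (PowerSeries.mk _)]
  cases k with
  | zero => simp
  | succ k => simp [PowerSeries.coeff_succ_mul_X, PowerSeries.coeff_one, pow_succ']

theorem coeff_prod_mk_pow (N d : ℕ) :
    PowerSeries.coeff d (∏ l : Fin N, PowerSeries.mk fun k => (X l : MvPolynomial (Fin N) ℂ) ^ k) =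
      completeHomog N d := by
  rw [PowerSeries.coeff_prod, completeHomog]
  refine Finset.sum_congr rfl fun m _ => ?_
  simp only [PowerSeries.coeff_mk]
  rw [monomial_eq, C_1, one_mul, Finsupp.prod_fintype _ _ fun _ => pow_zero _]

/-- The generating polynomial `∏_{i ≠ l} (1 - x_i t)` of the signed elementary symmetric
polynomials in the variables other than `x_l`. -/
noncomputable def elemGen {N : ℕ} (l : Fin N) : Polynomial (MvPolynomial (Fin N) ℂ) :=
  ∏ i ∈ Finset.univ.erase l, (1 - Polynomial.C (X i) * Polynomial.X)

theorem coeff_elemGen_eq_zero {N : ℕ} (l : Fin N) {b : ℕ} (hb : N ≤ b) :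
    (elemGen l).coeff b = 0 := by
  refine Polynomial.coeff_eq_zero_of_natDegree_lt (lt_of_le_of_lt
    (Polynomial.natDegree_prod_le _ _) ?_)
  have h1 : ∀ i ∈ Finset.univ.erase l,
      (1 - Polynomial.C (X i : MvPolynomial (Fin N) ℂ) * Polynomial.X).natDegree ≤ 1 := by
    intro i _
    compute_degree
  refine (Finset.sum_le_sum h1).trans_lt ?_
  rw [Finset.sum_const, Finset.card_erase_of_mem (Finset.mem_univ _), Finset.card_fin]
  have := l.pos
  simp only [smul_eq_mul, mul_one]
  omega

theorem jacobiTrudiMatrix_mul {N : ℕ} (α : Fin N → ℕ) :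
    jacobiTrudiMatrix α * .of (fun k l => (elemGen l).coeff (N - 1 - (k : ℕ))) =
      .of fun j l => (X l : MvPolynomial (Fin N) ℂ) ^ α j := by
  ext1 j l
  set a := α j with ha
  -- the coefficient of `t ^ a` in `∏_i (1 - x_i t)⁻¹ * ∏_{i ≠ l} (1 - x_i t) = (1 - x_l t)⁻¹`
  have hser : (elemGen l : PowerSeries (MvPolynomial (Fin N) ℂ)) *
      ∏ i : Fin N, PowerSeries.mk (fun k => (X i : MvPolynomial (Fin N) ℂ) ^ k) =
      PowerSeries.mk fun k => (X l : MvPolynomial (Fin N) ℂ) ^ k := by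
    rw [← Finset.mul_prod_erase Finset.univ _ (Finset.mem_univ l), mul_left_comm, elemGen]
    rw [← Polynomial.coeToPowerSeries.ringHom_apply, map_prod, ← Finset.prod_mul_distrib]
    rw [Finset.prod_eq_one, mul_one]
    intro i _
    rw [mul_comm, ← mk_pow_mul_one_sub (X i : MvPolynomial (Fin N) ℂ)]
    simp
  have hco := congrArg (PowerSeries.coeff a) hser
  rw [PowerSeries.coeff_mk, PowerSeries.coeff_mul,
    Finset.Nat.sum_antidiagonal_eq_sum_range_succ_mk] at hco
  simp only [coeff_prod_mk_pow, Polynomial.coeff_coe] at hco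
  rw [Matrix.mul_apply, Matrix.of_apply, ← hco]
  simp only [jacobiTrudiMatrix, Matrix.of_apply, ← ha]
  let F : ℕ → MvPolynomial (Fin N) ℂ := fun b =>
    (if b ≤ a then completeHomog N (a - b) else 0) * (elemGen l).coeff b
  have h1 : ∑ k : Fin N, F (N - 1 - k) = ∑ b ∈ Finset.range N, F b := by
    rw [← Fin.sum_univ_eq_sum_range, ← Equiv.sum_comp Fin.revPerm]
    refine Finset.sum_congr rfl fun k _ => ?_
    rw [Fin.revPerm_apply, Fin.val_rev, Nat.sub_sub, add_comm]
    have := k.2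
    congr 1
    omega
  refine h1.trans ?_
  have h2 : ∑ b ∈ Finset.range N, F b = ∑ b ∈ Finset.range (max N (a + 1)), F b := by
    refine Finset.sum_subset (Finset.range_mono (le_max_left _ _)) fun b _ hb => ?_
    rw [Finset.mem_range, not_lt] at hb
    simp only [F]
    rw [coeff_elemGen_eq_zero l hb, mul_zero]
  have h3 : ∑ b ∈ Finset.range (a + 1), F b = ∑ b ∈ Finset.range (max N (a + 1)), F b := by
    refine Finset.sum_subset (Finset.range_mono (le_max_right _ _)) fun b _ hb => ?_
    rw [Finset.mem_range, not_lt] at hb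
    simp only [F]
    rw [if_neg (by omega), zero_mul]
  rw [h2, ← h3]
  refine Finset.sum_congr rfl fun b hb => ?_
  simp only [F]
  rw [if_pos (Nat.lt_succ_iff.1 (Finset.mem_range.1 hb)), mul_comm]

theorem deltaPoly_eq_det (N : ℕ) :
    deltaPoly N = (Matrix.of fun j l : Fin N =>
      (X l : MvPolynomial (Fin N) ℂ) ^ (N - 1 - (j : ℕ))).det := by
  have h := Matrix.det_projVandermonde (1 : Fin N → MvPolynomial (Fin N) ℂ) X
  rw [← Matrix.det_transpose]
  convert h.symm using 2
  · refine Finset.prod_congr rfl fun i _ => Finset.prod_congr rfl fun j _ => ?_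
    simp
  · ext1 i j
    rw [Matrix.projVandermonde_apply, Matrix.transpose_apply, Matrix.of_apply, Fin.val_rev,
      Pi.one_apply, one_pow, one_mul, Nat.sub_sub, add_comm]

/-- Jacobi–Trudi, in alternant form: the complete homogeneous determinant of `α` is the quotient
of the alternant of `α` by the Vandermonde determinant. -/
theorem deltaPoly_mul_det {N : ℕ} (α : Fin N → ℕ) :
    deltaPoly N * (jacobiTrudiMatrix α).det =
      (Matrix.of fun j l => (X l : MvPolynomial (Fin N) ℂ) ^ α j).det := by
  have h1 : (jacobiTrudiMatrix fun j : Fin N => N - 1 - (j : ℕ)).det = 1 := by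
    rw [Matrix.det_of_isUpperTriangular]
    · refine Finset.prod_eq_one fun j _ => ?_
      rw [jacobiTrudiMatrix, Matrix.of_apply, if_pos le_rfl, Nat.sub_self, completeHomog]
      simp
    · intro j k hjk
      have hjk : (k : ℕ) < j := hjk
      have := j.2
      rw [jacobiTrudiMatrix, Matrix.of_apply, if_neg (by omega)]
  have h2 := congrArg Matrix.det (jacobiTrudiMatrix_mul fun j : Fin N => N - 1 - (j : ℕ))
  rw [Matrix.det_mul, h1, one_mul, ← deltaPoly_eq_det] at h2
  rw [← jacobiTrudiMatrix_mul, Matrix.det_mul, h2, mul_comm]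

/-! ### The standard filling -/

theorem tableau_injective {n : ℕ} (lam : n.Partition) :
    Function.Injective fun k => (tableauRow lam k, tableauCol lam k) := by
  intro k l h
  simp only [Prod.mk.injEq, tableauRow, tableauCol, Composition.coe_invEmbedding] at h
  have hk := (orderedParts lam).sizeUpTo_index_le k
  have hl := (orderedParts lam).sizeUpTo_index_le l
  obtain ⟨h1, h2⟩ := h
  rw [h1] at h2 hk
  exact Fin.ext (by omega)

theorem exists_tableau_eq {n : ℕ} (lam : n.Partition) {r c : ℕ} (h : c < part lam r) :
    ∃ k, tableauRow lam k = r ∧ tableauCol lam k = c := by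
  have hr : r < (orderedParts lam).length := by
    by_contra hr
    rw [part, List.getD_eq_default _ _ (by simpa using hr)] at h
    omega
  have hc : c < (orderedParts lam).blocksFun ⟨r, hr⟩ := by
    rw [part, List.getD_eq_getElem _ _ hr] at h
    exact h
  refine ⟨(orderedParts lam).embedding ⟨r, hr⟩ ⟨c, hc⟩, ?_, ?_⟩
  · rw [tableauRow, Composition.index_embedding]
  · rw [tableauCol, Composition.invEmbedding_comp]

theorem tableauCol_lt {n : ℕ} (lam : n.Partition) (k : Fin n) :
    tableauCol lam k < part lam (tableauRow lam k) := by
  rw [part, tableauRow, tableauCol, List.getD_eq_getElem _ _ (Fin.is_lt _)]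
  exact Fin.is_lt _

theorem part_antitone {n : ℕ} (lam : n.Partition) : Antitone (part lam) := by
  intro r s hrs
  rcases lt_or_ge s (orderedParts lam).blocks.length with hs | hs
  · rw [part, part, List.getD_eq_getElem _ _ hs, List.getD_eq_getElem _ _ (hrs.trans_lt hs)]
    have := List.pairwise_iff_get.1 (Multiset.pairwise_sort lam.parts (· ≥ ·))
    rcases hrs.eq_or_lt with rfl | hrs
    · rfl
    · exact this ⟨r, hrs.trans hs⟩ ⟨s, hs⟩ hrs
  · rw [part, List.getD_eq_default _ _ hs]
    exact Nat.zero_le _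

theorem tableauRow_lt {n : ℕ} (lam : n.Partition) (k : Fin n) :
    tableauRow lam k < Multiset.card lam.parts := by
  have h : (orderedParts lam).blocks.length = Multiset.card lam.parts := Multiset.length_sort _
  exact h ▸ ((orderedParts lam).index k).2

theorem card_tableauRow_eq {n : ℕ} (lam : n.Partition) (r : ℕ) :
    (Finset.univ.filter fun k => tableauRow lam k = r).card = part lam r := by
  rw [← Finset.card_range (part lam r)]
  refine Finset.card_bij (fun k _ => tableauCol lam k) ?_ ?_ ?_
  · intro k hk
    rw [← (Finset.mem_filter.1 hk).2]
    exact Finset.mem_range.2 (tableauCol_lt lam k)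
  · intro k hk l hl h
    exact tableau_injective lam (Prod.ext
      ((Finset.mem_filter.1 hk).2.trans (Finset.mem_filter.1 hl).2.symm) h)
  · intro c hc
    obtain ⟨k, h1, h2⟩ := exists_tableau_eq lam (Finset.mem_range.1 hc)
    exact ⟨k, by simpa using h1, h2⟩

theorem sum_range_card_le_sum (S : Finset ℕ) : ∑ i ∈ Finset.range S.card, i ≤ ∑ i ∈ S, i := by
  induction S using Finset.induction_on_max with
  | empty => simp
  | insert a s h ih =>
    have ha : a ∉ s := fun h' => (h a h').false
    have : s.card ≤ a := by
      simpa using Finset.card_le_card (fun x hx => Finset.mem_range.2 (h x hx))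
    rw [Finset.card_insert_of_notMem ha, Finset.sum_range_succ, Finset.sum_insert ha]
    omega

theorem eq_range_of_sum_le (S : Finset ℕ) (hS : ∑ i ∈ S, i ≤ ∑ i ∈ Finset.range S.card, i) :
    S = Finset.range S.card := by
  induction S using Finset.induction_on_max with
  | empty => simp
  | insert a s h ih =>
    have ha : a ∉ s := fun h' => (h a h').false
    have h1 : s.card ≤ a := by
      simpa using Finset.card_le_card (fun x hx => Finset.mem_range.2 (h x hx))
    rw [Finset.card_insert_of_notMem ha, Finset.sum_range_succ, Finset.sum_insert ha] at hS
    have h2 := sum_range_card_le_sum s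
    have h3 : a = s.card := by omega
    rw [Finset.card_insert_of_notMem ha, Finset.range_add_one, ← ih (by omega), ← h3]

theorem exists_lower_cell {n : ℕ} (lam : n.Partition) (k : Fin n) {r : ℕ}
    (hr : r ≤ tableauRow lam k) :
    ∃ l, tableauRow lam l = r ∧ tableauCol lam l = tableauCol lam k :=
  exists_tableau_eq lam ((tableauCol_lt lam k).trans_le (part_antitone lam hr))

/-- The columns of a Young diagram are initial segments. -/
theorem image_tableauRow_col {n : ℕ} (lam : n.Partition) (c : ℕ) :
    (Finset.univ.filter fun k => tableauCol lam k = c).image (tableauRow lam) =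
      Finset.range (Finset.univ.filter fun k => tableauCol lam k = c).card := by
  have hinj : Set.InjOn (tableauRow lam) (Finset.univ.filter fun k => tableauCol lam k = c) := by
    intro k hk l hl h
    simp only [Finset.coe_filter, Finset.mem_univ, true_and, Set.mem_ofPred_eq] at hk hl
    exact tableau_injective lam (Prod.ext h (hk.trans hl.symm))
  rw [← Finset.card_image_of_injOn hinj]
  refine (Finset.eq_of_subset_of_card_le (fun r hr => ?_) (by simp))
  obtain ⟨k, hk, rfl⟩ := Finset.mem_image.1 hr
  have hk := (Finset.mem_filter.1 hk).2
  have : Finset.range (tableauRow lam k + 1) ⊆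
      (Finset.univ.filter fun k => tableauCol lam k = c).image (tableauRow lam) := by
    intro s hs
    obtain ⟨l, h1, h2⟩ := exists_lower_cell lam k (Nat.lt_succ_iff.1 (Finset.mem_range.1 hs))
    exact Finset.mem_image.2 ⟨l, by simp [h2, hk], h1⟩
  simpa using Finset.card_le_card this

/-- Among the fillings of the diagram of `lam` with distinct entries in each column, the
filling of each cell by its row number has the least sum. -/
theorem sum_tableauRow_le {n : ℕ} (lam : n.Partition) (v : Fin n → ℕ)
    (hv : Function.Injective fun k => (v k, tableauCol lam k)) :
    ∑ k, tableauRow lam k ≤ ∑ k, v k ∧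
      (∑ k, v k ≤ ∑ k, tableauRow lam k →
        ∀ k, ∃ l, tableauRow lam l = v k ∧ tableauCol lam l = tableauCol lam k) := by
  classical
  let F : ℕ → Finset (Fin n) := fun c => Finset.univ.filter fun k => tableauCol lam k = c
  let I := Finset.univ.image (tableauCol lam)
  have hI : ∀ k ∈ (Finset.univ : Finset (Fin n)), tableauCol lam k ∈ I := fun k hk =>
    Finset.mem_image_of_mem _ hk
  have hrow : ∀ c, ∑ k ∈ F c, tableauRow lam k = ∑ i ∈ Finset.range (F c).card, i := by
    intro c
    rw [← image_tableauRow_col, Finset.sum_image]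
    intro k hk l hl h
    simp only [Finset.coe_filter, Finset.mem_univ, true_and, Set.mem_ofPred_eq] at hk hl
    exact tableau_injective lam (Prod.ext h (hk.trans hl.symm))
  have hinj : ∀ c, Set.InjOn v (F c) := by
    intro c k hk l hl h
    simp only [F, Finset.coe_filter, Finset.mem_univ, true_and, Set.mem_ofPred_eq] at hk hl
    exact hv (Prod.ext h (hk.trans hl.symm))
  have hvs : ∀ c, ∑ k ∈ F c, v k = ∑ i ∈ (F c).image v, i := fun c =>
    (Finset.sum_image (f := fun i => i) (hinj c)).symm
  have hcard : ∀ c, ((F c).image v).card = (F c).card := fun c =>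
    Finset.card_image_of_injOn (hinj c)
  have hle : ∀ c, ∑ k ∈ F c, tableauRow lam k ≤ ∑ k ∈ F c, v k := by
    intro c
    rw [hrow, hvs, ← hcard]
    exact sum_range_card_le_sum _
  rw [← Finset.sum_fiberwise_of_maps_to hI, ← Finset.sum_fiberwise_of_maps_to hI]
  refine ⟨Finset.sum_le_sum fun c _ => hle c, fun h k => ?_⟩
  have heq := (Finset.sum_eq_sum_iff_of_le fun c _ => hle c).1
    (le_antisymm (Finset.sum_le_sum fun c _ => hle c) h) (tableauCol lam k) (hI k (by simp))
  have h1 : (F (tableauCol lam k)).image v = Finset.range (F (tableauCol lam k)).card := by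
    have := eq_range_of_sum_le ((F (tableauCol lam k)).image v)
      (by rw [hcard, ← hrow, ← hvs]; exact heq.ge)
    rwa [hcard] at this
  have h2 : v k ∈ (F (tableauCol lam k)).image (tableauRow lam) := by
    rw [image_tableauRow_col, ← h1]
    exact Finset.mem_image_of_mem _ (by simp [F])
  obtain ⟨l, hl, hl'⟩ := Finset.mem_image.1 h2
  exact ⟨l, hl', (Finset.mem_filter.1 hl).2⟩

/-! ### Virtual characters from alternants -/

/-- The exponent `(N - 1 - σ(j))_j`, that is, `ρ` permuted by `σ`. -/
noncomputable def rhoPerm {N : ℕ} (σ : Equiv.Perm (Fin N)) : Fin N →₀ ℕ :=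
  Finsupp.equivFunOnFinite.symm fun j => N - 1 - (σ j : ℕ)

/-- The enumerator, by content, of the words fixed by `g`. -/
noncomputable def fixedWords {n : ℕ} (N : ℕ) (g : Equiv.Perm (Fin n)) : MvPolynomial (Fin N) ℂ :=
  ∑ w : Fin n → Fin N with w ∘ g = w, monomial (content w) 1

/-- The character of the permutation representation on the words of content `α`. -/
noncomputable def wordChar {n N : ℕ} (α : Fin N →₀ ℕ) (g : Equiv.Perm (Fin n)) : ℕ :=
  (Finset.univ.filter fun w : Fin n → Fin N => w ∘ g = w ∧ content w = α).card

/-- The class function whose value at `g` is the coefficient of `x^β` in the Vandermonde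
determinant times the power sums of `g`, written as an alternating sum of permutation
characters. -/
noncomputable def alternantChar {n N : ℕ} (β : Fin N →₀ ℕ) (g : Equiv.Perm (Fin n)) : ℤ :=
  ∑ σ : Equiv.Perm (Fin N), (sign σ : ℤ) * if rhoPerm σ ≤ β then wordChar (β - rhoPerm σ) g else 0

theorem coeff_fixedWords {n N : ℕ} (α : Fin N →₀ ℕ) (g : Equiv.Perm (Fin n)) :
    coeff α (fixedWords N g) = wordChar α g := by
  rw [fixedWords, coeff_sum, wordChar, ← Finset.filter_filter, Finset.card_filter]
  push_cast
  exact Finset.sum_congr rfl fun w _ => coeff_monomial _ _ _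

theorem det_X_pow {N : ℕ} (α : Fin N → ℕ) :
    (Matrix.of fun j l => (X l : MvPolynomial (Fin N) ℂ) ^ α j).det =
      ∑ σ : Equiv.Perm (Fin N),
        monomial (Finsupp.equivFunOnFinite.symm fun l => α (σ l)) ((sign σ : ℤ) : ℂ) := by
  rw [Matrix.det_apply']
  refine Finset.sum_congr rfl fun σ _ => ?_
  rw [monomial_eq, Finsupp.prod_fintype _ _ fun _ => pow_zero _]
  congr 1

theorem coeff_deltaPoly_mul_fixedWords {n N : ℕ} (β : Fin N →₀ ℕ) (g : Equiv.Perm (Fin n)) :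
    coeff β (deltaPoly N * fixedWords N g) = alternantChar β g := by
  rw [deltaPoly_eq_det, det_X_pow fun j : Fin N => N - 1 - (j : ℕ), Finset.sum_mul, coeff_sum,
    alternantChar]
  push_cast
  refine Finset.sum_congr rfl fun σ _ => ?_
  rw [coeff_monomial_mul', coeff_fixedWords, mul_ite, mul_zero]
  rfl

/-- A sum over words weighted by stabilizers is a sum over contents. -/
theorem sum_stabCard_smul {n : ℕ} {ι M : Type*} [Fintype ι] [DecidableEq ι] [AddCommMonoid M]
    (f : (ι →₀ ℕ) → M) :
    ∑ w : Fin n → ι, stabCard w • f (content w) =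
      n.factorial • ∑ c ∈ Finset.finsuppAntidiag Finset.univ n, f c := by
  have hmem : ∀ w : Fin n → ι, content w ∈ Finset.finsuppAntidiag Finset.univ n := by
    intro w
    rw [Finset.mem_finsuppAntidiag]
    exact ⟨by simpa using sum_content_mul w fun _ => 1, Finset.subset_univ _⟩
  rw [← Finset.sum_fiberwise_of_maps_to fun w _ => hmem w, Finset.smul_sum]
  refine Finset.sum_congr rfl fun c hc => ?_
  rw [← sum_stabCard c (Finset.mem_finsuppAntidiag.1 hc).1, Finset.sum_smul]
  exact Finset.sum_congr rfl fun w hw => by rw [(Finset.mem_filter.1 hw).2]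

theorem content_fst {n N : ℕ} (z : Fin n → Fin N × Fin N) :
    content (fun k => (z k).1) =
      Finsupp.equivFunOnFinite.symm fun j => ∑ l, content z (j, l) := by
  ext j
  simp only [content, Finsupp.finsetSum_apply, Finsupp.equivFunOnFinite_symm_apply_apply]
  rw [Finset.sum_comm]
  refine Finset.sum_congr rfl fun k _ => ?_
  simp [Finsupp.single_apply, Prod.ext_iff, ite_and]

theorem content_snd {n N : ℕ} (z : Fin n → Fin N × Fin N) :
    content (fun k => (z k).2) =
      Finsupp.equivFunOnFinite.symm fun l => ∑ j, content z (j, l) := by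
  ext l
  simp only [content, Finsupp.finsetSum_apply, Finsupp.equivFunOnFinite_symm_apply_apply]
  rw [Finset.sum_comm]
  refine Finset.sum_congr rfl fun k _ => ?_
  simp [Finsupp.single_apply, Prod.ext_iff, ite_and]

/-- A product of complete homogeneous polynomials enumerates, by column sums, the matrices with
prescribed row sums. -/
theorem prod_completeHomog {n N : ℕ} (α : Fin N →₀ ℕ) (hα : ∑ j, α j = n) :
    ∏ j, completeHomog N (α j) =
      ∑ c ∈ Finset.finsuppAntidiag (Finset.univ : Finset (Fin N × Fin N)) n,
        if (Finsupp.equivFunOnFinite.symm fun j => ∑ l, c (j, l)) = α then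
          monomial (Finsupp.equivFunOnFinite.symm fun l => ∑ j, c (j, l)) 1 else 0 := by
  classical
  simp only [completeHomog]
  rw [Finset.prod_univ_sum, ← Finset.sum_filter]
  refine Finset.sum_bij'
    (fun p _ => Finsupp.equivFunOnFinite.symm fun x : Fin N × Fin N => p x.1 x.2)
    (fun c _ => fun j => Finsupp.equivFunOnFinite.symm fun l => c (j, l)) ?_ ?_ ?_ ?_ ?_
  · intro p hp
    have hp : ∀ j, ∑ l, p j l = α j := fun j =>
      (Finset.mem_finsuppAntidiag.1 (Fintype.mem_piFinset.1 hp j)).1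
    rw [Finset.mem_filter, Finset.mem_finsuppAntidiag]
    refine ⟨⟨?_, Finset.subset_univ _⟩, ?_⟩
    · simp only [Finsupp.equivFunOnFinite_symm_apply_apply]
      rw [Fintype.sum_prod_type, ← hα]
      exact Finset.sum_congr rfl fun j _ => hp j
    · ext j
      simpa using hp j
  · intro c hc
    rw [Finset.mem_filter] at hc
    rw [Fintype.mem_piFinset]
    intro j
    rw [Finset.mem_finsuppAntidiag]
    refine ⟨?_, Finset.subset_univ _⟩
    rw [← hc.2]
    simp
  · intro p _
    ext j l
    simp
  · intro c _
    ext x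
    simp
  · intro p _
    rw [← monomial_sum_one]
    refine congrArg (fun m => monomial m 1) (Finsupp.ext fun l => ?_)
    simp [Finsupp.finsetSum_apply]

/-- Averaging the words fixed by `g` against the permutation character of content `α` gives
`h_α`: both sides count orbits of pairs of words. -/
theorem sum_wordChar_smul_fixedWords {n N : ℕ} (α : Fin N →₀ ℕ) (hα : ∑ j, α j = n) :
    ∑ g : Equiv.Perm (Fin n), wordChar α g • fixedWords N g =
      n.factorial • ∏ j, completeHomog N (α j) := by
  classical
  rw [prod_completeHomog α hα, ← sum_stabCard_smul]
  simp only [← content_fst, ← content_snd]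
  rw [← Equiv.sum_comp (Equiv.arrowProdEquivProdArrow (Fin n) (fun _ => Fin N) fun _ => Fin N).symm,
    Fintype.sum_prod_type]
  simp only [wordChar, Finset.card_filter, fixedWords, Finset.sum_filter, stabCard, Finset.sum_smul]
  simp only [Finset.smul_sum]
  rw [Finset.sum_comm]
  refine Finset.sum_congr rfl fun w _ => ?_
  rw [Finset.sum_comm]
  refine Finset.sum_congr rfl fun u _ => Finset.sum_congr rfl fun g _ => ?_
  have : (Equiv.arrowProdEquivProdArrow (Fin n) (fun _ => Fin N) fun _ => Fin N).symm (w, u) ∘ g =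
      (Equiv.arrowProdEquivProdArrow (Fin n) (fun _ => Fin N) fun _ => Fin N).symm (w, u) ↔
      w ∘ g = w ∧ u ∘ g = u := by
    simp only [funext_iff, ← forall_and]
    exact forall_congr' fun k => Prod.ext_iff
  rw [if_congr this rfl rfl]
  change (if w ∘ g = w ∧ content w = α then 1 else 0) • (if u ∘ g = u then _ else _) =
    (if w ∘ g = w ∧ u ∘ g = u then 1 else 0) • (if content w = α then monomial (content u) 1 else 0)
  by_cases h1 : w ∘ g = w <;> by_cases h2 : u ∘ g = u <;> by_cases h3 : content w = α <;>
    simp [h1, h2, h3]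

theorem det_jacobiTrudiMatrix {N : ℕ} (β : Fin N →₀ ℕ) :
    (jacobiTrudiMatrix β).det = ∑ σ : Equiv.Perm (Fin N), ((sign σ : ℤ) : MvPolynomial (Fin N) ℂ) *
      if rhoPerm σ ≤ β then ∏ j, completeHomog N ((β - rhoPerm σ) j) else 0 := by
  rw [← Matrix.det_transpose, Matrix.det_apply']
  refine Finset.sum_congr rfl fun σ _ => ?_
  simp only [Matrix.transpose_apply, jacobiTrudiMatrix, Matrix.of_apply]
  rw [Finset.prod_ite_zero]
  congr 1
  have : (∀ i ∈ Finset.univ, N - 1 - (σ i : ℕ) ≤ β i) ↔ rhoPerm σ ≤ β :=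
    ⟨fun h i => h i (Finset.mem_univ i), fun h i _ => h i⟩
  by_cases h : rhoPerm σ ≤ β
  · rw [if_pos h, if_pos (this.2 h)]
    rfl
  · rw [if_neg h, if_neg fun h' => h (this.1 h')]

theorem coeff_alternant_self {N : ℕ} (β : Fin N →₀ ℕ) (hβ : Function.Injective β) :
    coeff β (Matrix.of fun j l => (X l : MvPolynomial (Fin N) ℂ) ^ β j).det = 1 := by
  rw [det_X_pow, coeff_sum, Finset.sum_eq_single 1]
  · rw [coeff_monomial, if_pos (by ext; simp)]
    simp
  · intro σ _ hσ
    rw [coeff_monomial, if_neg]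
    intro h
    refine hσ (Equiv.ext fun l => hβ ?_)
    simpa using DFunLike.congr_fun h l
  · simp

theorem sum_sub_rhoPerm {n N : ℕ} {β : Fin N →₀ ℕ}
    (hβ : ∑ j, β j = n + ∑ j : Fin N, (N - 1 - (j : ℕ)))
    {σ : Equiv.Perm (Fin N)} (hσ : rhoPerm σ ≤ β) : ∑ j, (β - rhoPerm σ) j = n := by
  have h1 : ∑ j, (β - rhoPerm σ) j + ∑ j, rhoPerm σ j = ∑ j, β j := by
    rw [← Finset.sum_add_distrib]
    exact Finset.sum_congr rfl fun j _ => Nat.sub_add_cancel (hσ j)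
  have h2 : ∑ j, rhoPerm σ j = ∑ j : Fin N, (N - 1 - (j : ℕ)) :=
    Equiv.sum_comp σ fun j : Fin N => N - 1 - (j : ℕ)
  omega

/-- The virtual characters attached to exponents with distinct parts have norm one. -/
theorem sum_alternantChar_mul_self {n N : ℕ} (β : Fin N →₀ ℕ) (hinj : Function.Injective β)
    (hβ : ∑ j, β j = n + ∑ j : Fin N, (N - 1 - (j : ℕ))) :
    ∑ g : Equiv.Perm (Fin n), ((alternantChar β g : ℤ) : ℂ) * (alternantChar β g : ℤ) =
      n.factorial := by
  have hσ : ∀ σ : Equiv.Perm (Fin N),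
      ∑ g : Equiv.Perm (Fin n),
        ((if rhoPerm σ ≤ β then wordChar (β - rhoPerm σ) g else 0 : ℕ) : ℂ) *
        coeff β (deltaPoly N * fixedWords N g) =
      n.factorial * coeff β (deltaPoly N *
        if rhoPerm σ ≤ β then ∏ j, completeHomog N ((β - rhoPerm σ) j) else 0) := by
    intro σ
    split_ifs with h
    · simp only [← nsmul_eq_mul, ← coeff_smul, ← coeff_sum, ← mul_smul_comm, ← Finset.mul_sum]
      rw [sum_wordChar_smul_fixedWords _ (sum_sub_rhoPerm hβ h)]
    · simp
  calc _ = ∑ g : Equiv.Perm (Fin n), ∑ σ : Equiv.Perm (Fin N), ((sign σ : ℤ) : ℂ) *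
        (((if rhoPerm σ ≤ β then wordChar (β - rhoPerm σ) g else 0 : ℕ) : ℂ) *
          coeff β (deltaPoly N * fixedWords N g)) := by
        refine Finset.sum_congr rfl fun g _ => ?_
        rw [coeff_deltaPoly_mul_fixedWords, ← Finset.sum_congr rfl fun σ _ => mul_assoc _ _ _,
          ← Finset.sum_mul]
        congr 1
        rw [alternantChar]
        push_cast
        rfl
    _ = n.factorial * coeff β (deltaPoly N * (jacobiTrudiMatrix β).det) := by
        rw [Finset.sum_comm, det_jacobiTrudiMatrix, Finset.mul_sum, coeff_sum, Finset.mul_sum]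
        refine Finset.sum_congr rfl fun σ _ => ?_
        rw [← Finset.mul_sum, hσ, mul_left_comm (deltaPoly N),
          ← map_intCast (C : ℂ →+* MvPolynomial (Fin N) ℂ),
          coeff_C_mul, mul_left_comm]
    _ = n.factorial := by
        rw [deltaPoly_mul_det, coeff_alternant_self β hinj, mul_one]

/-! ### Sandwiching between row and column symmetrizers -/

/-- The sum in the group algebra of the permutations that fix the word `w`. -/
noncomputable def stabSum {n : ℕ} {ι : Type*} [DecidableEq ι] (w : Fin n → ι) :
    MonoidAlgebra ℂ (Equiv.Perm (Fin n)) :=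
  ∑ g ∈ Finset.univ.filter fun g : Equiv.Perm (Fin n) => w ∘ g = w,
    MonoidAlgebra.of ℂ (Equiv.Perm (Fin n)) g

theorem stabSum_mul_of {n : ℕ} {ι : Type*} [DecidableEq ι] (w : Fin n → ι)
    {t : Equiv.Perm (Fin n)} (ht : w ∘ t = w) :
    stabSum w * MonoidAlgebra.of ℂ _ t = stabSum w := by
  rw [stabSum, Finset.sum_mul]
  have ht' : w ∘ ⇑t⁻¹ = w := by
    ext k
    simpa using (congrFun ht (t⁻¹ k)).symm
  refine Finset.sum_bij' (fun g _ => g * t) (fun g _ => g * t⁻¹) ?_ ?_ (by simp) (by simp) ?_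
  · intro g hg
    have hg := (Finset.mem_filter.1 hg).2
    refine Finset.mem_filter.2 ⟨Finset.mem_univ _, ?_⟩
    rw [Equiv.Perm.coe_mul, ← Function.comp_assoc, hg, ht]
  · intro g hg
    have hg := (Finset.mem_filter.1 hg).2
    refine Finset.mem_filter.2 ⟨Finset.mem_univ _, ?_⟩
    rw [Equiv.Perm.coe_mul, ← Function.comp_assoc, hg, ht']
  · intro g _
    rw [map_mul]

theorem mem_fiberSubgroup_iff {n : ℕ} {ι : Type*} (w : Fin n → ι) (g : Equiv.Perm (Fin n)) :
    g ∈ fiberSubgroup w ↔ w ∘ g = w :=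
  funext_iff.symm

theorem stabCard_smul_rowProjector {n : ℕ} (lam : n.Partition) :
    (stabCard (tableauRow lam) : ℂ) • rowProjector lam = stabSum (tableauRow lam) := by
  classical
  have hcard : stabCard (tableauRow lam) = Nat.card (rowSubgroup lam) := by
    rw [stabCard, Nat.card_eq_fintype_card]
    exact (Fintype.card_of_subtype _ fun g => by
      simp [rowSubgroup, mem_fiberSubgroup_iff]).symm
  rw [rowProjector, hcard, smul_smul, mul_inv_cancel₀ (Nat.cast_ne_zero.2 Nat.card_pos.ne'),
    one_smul, stabSum]
  exact (Finset.sum_subtype _ (fun g => by simp [rowSubgroup, mem_fiberSubgroup_iff])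
    fun g => MonoidAlgebra.of ℂ (Equiv.Perm (Fin n)) g).symm

theorem stabCard_pos {n : ℕ} {ι : Type*} [DecidableEq ι] (w : Fin n → ι) : 0 < stabCard w :=
  Finset.card_pos.2 ⟨1, by simp⟩

theorem rowProjector_eq {n : ℕ} (lam : n.Partition) :
    rowProjector lam = (stabCard (tableauRow lam) : ℂ)⁻¹ • stabSum (tableauRow lam) := by
  rw [← stabCard_smul_rowProjector, inv_smul_smul₀ (Nat.cast_ne_zero.2 (stabCard_pos _).ne')]

theorem rowProjector_mul_of {n : ℕ} (lam : n.Partition) {p : Equiv.Perm (Fin n)}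
    (hp : p ∈ rowSubgroup lam) :
    rowProjector lam * MonoidAlgebra.of ℂ _ p = rowProjector lam := by
  rw [rowProjector_eq, smul_mul_assoc, stabSum_mul_of _ ((mem_fiberSubgroup_iff _ _).1 hp)]

theorem rowProjector_mul_self {n : ℕ} (lam : n.Partition) :
    rowProjector lam * rowProjector lam = rowProjector lam := by
  classical
  conv_lhs => enter [2]; rw [rowProjector]
  rw [mul_smul_comm, Finset.mul_sum, Finset.sum_congr rfl fun p _ => rowProjector_mul_of lam p.2,
    Finset.sum_const, Finset.card_univ, Nat.card_eq_fintype_card, ← Nat.cast_smul_eq_nsmul ℂ,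
    inv_smul_smul₀ (Nat.cast_ne_zero.2 Fintype.card_ne_zero)]

theorem of_mul_colProjector {n : ℕ} (lam : n.Partition) {q : Equiv.Perm (Fin n)}
    (hq : q ∈ colSubgroup lam) :
    MonoidAlgebra.of ℂ _ q * colProjector lam = ((sign q : ℤ) : ℂ) • colProjector lam := by
  classical
  rw [colProjector, mul_smul_comm, smul_comm]
  congr 1
  rw [Finset.mul_sum, Finset.smul_sum]
  refine Fintype.sum_equiv (Equiv.mulLeft (⟨q, hq⟩ : colSubgroup lam)) _ _ fun g => ?_
  rw [Equiv.coe_mulLeft, Subgroup.coe_mul, mul_smul_comm, Equiv.Perm.sign_mul, ← map_mul, smul_smul]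
  congr 1
  have : ((sign q : ℤ) : ℂ) * ((sign q : ℤ) : ℂ) = 1 := by
    rw [← Int.cast_mul, ← Units.val_mul, Int.units_mul_self]; simp
  push_cast
  rw [← mul_assoc, this, one_mul]

/-- If two positions in one column carry equal letters, the transposition exchanging them is
absorbed with sign `1` on the left and with sign `-1` on the right. -/
theorem stabSum_mul_of_mul_colProjector_eq_zero {n : ℕ} {ι : Type*} [DecidableEq ι]
    (lam : n.Partition) (w : Fin n → ι) (x : Equiv.Perm (Fin n))
    (h : ¬ Function.Injective fun k => (w (x k), tableauCol lam k)) :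
    stabSum w * MonoidAlgebra.of ℂ _ x * colProjector lam = 0 := by
  simp only [Function.Injective, not_forall, Prod.mk.injEq] at h
  obtain ⟨k, l, ⟨hw, hc⟩, hkl⟩ := h
  have ht : w ∘ Equiv.swap (x k) (x l) = w := by
    ext m
    rw [Function.comp_apply, Equiv.apply_swap_eq_self hw]
  have hq : Equiv.swap k l ∈ colSubgroup lam := fun m => Equiv.apply_swap_eq_self hc m
  have key : stabSum w * MonoidAlgebra.of ℂ _ x * colProjector lam =
      -(stabSum w * MonoidAlgebra.of ℂ _ x * colProjector lam) := by
    conv_lhs => rw [← stabSum_mul_of w ht]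
    rw [mul_assoc (stabSum w), ← map_mul, ← Equiv.mul_swap_eq_swap_mul, map_mul, mul_assoc,
      mul_assoc, of_mul_colProjector lam hq, sign_swap hkl]
    simp [mul_assoc]
  have h2 : (2 : ℂ) • (stabSum w * MonoidAlgebra.of ℂ _ x * colProjector lam) = 0 := by
    rw [two_smul]
    exact eq_neg_iff_add_eq_zero.1 key
  exact (smul_eq_zero.1 h2).resolve_left two_ne_zero

/-- A word whose letters have too small a sum cannot be rearranged to have distinct letters in each
column. -/
theorem stabSum_mul_mul_colProjector_eq_zero {n N : ℕ} (lam : n.Partition) (w : Fin n → Fin N)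
    (h : ∑ j, content w j * (j : ℕ) < ∑ k, tableauRow lam k)
    (y : MonoidAlgebra ℂ (Equiv.Perm (Fin n))) : stabSum w * y * colProjector lam = 0 := by
  induction y using MonoidAlgebra.induction_on with
  | of x =>
    refine stabSum_mul_of_mul_colProjector_eq_zero lam w x fun hinj => ?_
    have h1 := (sum_tableauRow_le lam (fun k => (w (x k) : ℕ)) fun k l hkl => hinj <| by
      simpa [Fin.ext_iff] using hkl).1
    rw [sum_content_mul w fun j => (j : ℕ), ← Equiv.sum_comp x] at h
    omega
  | add f g hf hg => rw [mul_add, add_mul, hf, hg, add_zero]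
  | smul r f hf => rw [mul_smul_comm, smul_mul_assoc, hf, smul_zero]

/-- A permutation that moves no two elements of a column into one row is a product of a row
permutation and a column permutation, so everything between the two projectors collapses to the
line of the Young symmetrizer. -/
theorem exists_rowProjector_mul_mul_colProjector {n : ℕ} (lam : n.Partition)
    (y : MonoidAlgebra ℂ (Equiv.Perm (Fin n))) :
    ∃ r : ℂ, rowProjector lam * y * colProjector lam = r • youngSymmetrizer lam := by
  induction y using MonoidAlgebra.induction_on with
  | of x =>
    by_cases hinj : Function.Injective fun k => (tableauRow lam (x k), tableauCol lam k)
    · have h1 := (sum_tableauRow_le lam (fun k => tableauRow lam (x k)) hinj).2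
        (Equiv.sum_comp x _).le
      choose q hqr hqc using h1
      have hq : Function.Injective q := fun k l hkl => hinj <| Prod.ext
        ((hqr k).symm.trans ((congrArg _ hkl).trans (hqr l)))
        ((hqc k).symm.trans ((congrArg _ hkl).trans (hqc l)))
      let Q : Equiv.Perm (Fin n) := Equiv.ofBijective q (Finite.injective_iff_bijective.1 hq)
      have hQ : Q ∈ colSubgroup lam := hqc
      have hP : x * Q⁻¹ ∈ rowSubgroup lam := fun k => by
        have := hqr (Q⁻¹ k)
        rw [Equiv.Perm.mul_apply, ← this]
        exact congrArg _ (Q.apply_symm_apply k)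
      refine ⟨((sign Q : ℤ) : ℂ), ?_⟩
      rw [← inv_mul_cancel_right x Q, map_mul, ← mul_assoc, rowProjector_mul_of lam hP, mul_assoc,
        of_mul_colProjector lam hQ, mul_smul_comm, youngSymmetrizer]
    · refine ⟨0, ?_⟩
      rw [rowProjector_eq, smul_mul_assoc, smul_mul_assoc,
        stabSum_mul_of_mul_colProjector_eq_zero lam _ x hinj, smul_zero, zero_smul]
  | add f g hf hg =>
    obtain ⟨r, hr⟩ := hf
    obtain ⟨s, hs⟩ := hg
    exact ⟨r + s, by rw [mul_add, add_mul, hr, hs, add_smul]⟩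
  | smul a f hf =>
    obtain ⟨r, hr⟩ := hf
    exact ⟨a * r, by rw [mul_smul_comm, smul_mul_assoc, hr, mul_smul]⟩

theorem coeff_youngSymmetrizer {n : ℕ} (lam : n.Partition) (h : Equiv.Perm (Fin n))
    [Fintype (rowSubgroup lam)] [Fintype (colSubgroup lam)] :
    (youngSymmetrizer lam).coeff h =
      (Nat.card (rowSubgroup lam) : ℂ)⁻¹ * (Nat.card (colSubgroup lam) : ℂ)⁻¹ *
        ((∑ p : rowSubgroup lam, ∑ q : colSubgroup lam,
          if (p * q : Equiv.Perm (Fin n)) = h then (sign (q : Equiv.Perm (Fin n)) : ℤ) else 0 : ℤ) :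
            ℂ) := by
  classical
  rw [youngSymmetrizer, rowProjector, colProjector, smul_mul_smul_comm, Finset.sum_mul_sum]
  simp only [mul_smul_comm, ← map_mul]
  rw [MonoidAlgebra.coeff_smul, Finsupp.smul_apply, smul_eq_mul]
  congr 1
  push_cast
  rw [MonoidAlgebra.coeff_sum, Finsupp.finsetSum_apply]
  refine Finset.sum_congr (by congr!) fun p _ => ?_
  rw [MonoidAlgebra.coeff_sum, Finsupp.finsetSum_apply]
  refine Finset.sum_congr (by congr!) fun q _ => ?_
  simp [MonoidAlgebra.of_apply, Finsupp.single_apply]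

/-- The identity arises only as `1 * 1`, because a row and a column meet in at most one cell. -/
theorem coeff_one_youngSymmetrizer_ne_zero {n : ℕ} (lam : n.Partition) :
    (youngSymmetrizer lam).coeff 1 ≠ 0 := by
  classical
  rw [coeff_youngSymmetrizer, Finset.sum_eq_single 1, Finset.sum_eq_single 1]
  · simp
  · intro q _ hq
    rw [if_neg]
    simpa using hq
  · simp
  · intro p _ hp
    refine Finset.sum_eq_zero fun q _ => if_neg fun hpq => hp ?_
    have hpc : (p : Equiv.Perm (Fin n)) ∈ colSubgroup lam := by
      rw [eq_inv_of_mul_eq_one_left hpq]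
      exact inv_mem q.2
    exact Subtype.ext (Equiv.ext fun k => tableau_injective lam (Prod.ext (p.2 k) (hpc k)))
  · simp

/-! ### The character of the Specht module -/

theorem trace_eq_of_range_le_span_singleton {V : Type*} [AddCommGroup V] [Module ℂ V]
    [FiniteDimensional ℂ V] (f : V →ₗ[ℂ] V) {u : V} (hu : u ≠ 0) (k : ℂ)
    (hf : ∀ v, ∃ r : ℂ, f v = r • u) (hk : f u = k • u) : LinearMap.trace ℂ V f = k := by
  choose r hr using hf
  have hinj : ∀ a b : ℂ, a • u = b • u → a = b := fun a b h => smul_left_injective ℂ hu h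
  let φ : V →ₗ[ℂ] ℂ :=
    { toFun := r
      map_add' := fun x y => hinj _ _ (by rw [← hr, map_add, hr, hr, add_smul])
      map_smul' := fun a x => hinj _ _ (by
        rw [← hr, map_smul, hr, smul_smul, RingHom.id_apply, smul_eq_mul]) }
  have : f = φ.smulRight u := LinearMap.ext hr
  rw [this, LinearMap.trace_smulRight]
  exact hinj _ _ ((hr u).symm.trans hk)

/-- The trace of the action of an element of the group algebra on the Specht module. -/
noncomputable def spechtTrace {n : ℕ} (lam : n.Partition) :
    MonoidAlgebra ℂ (Equiv.Perm (Fin n)) →ₗ[ℂ] ℂ :=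
  LinearMap.trace ℂ (spechtModule lam) ∘ₗ (Algebra.lsmul ℂ ℂ (spechtModule lam)).toLinearMap

theorem character_eq_spechtTrace {n : ℕ} (lam : n.Partition) (g : Equiv.Perm (Fin n)) :
    (spechtRep lam).character g = spechtTrace lam (MonoidAlgebra.of ℂ _ g) :=
  rfl

theorem exists_eq_mul_youngSymmetrizer {n : ℕ} {lam : n.Partition} (v : spechtModule lam) :
    ∃ y, (v : MonoidAlgebra ℂ (Equiv.Perm (Fin n))) = y * youngSymmetrizer lam := by
  obtain ⟨y, hy⟩ := Submodule.mem_span_singleton.1 v.2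
  exact ⟨y, hy.symm⟩

theorem youngSymmetrizer_ne_zero {n : ℕ} (lam : n.Partition) : youngSymmetrizer lam ≠ 0 :=
  fun h => coeff_one_youngSymmetrizer_ne_zero lam (by rw [h]; rfl)

theorem spechtTrace_eq_of_mul {n : ℕ} (lam : n.Partition)
    (x : MonoidAlgebra ℂ (Equiv.Perm (Fin n))) (k : ℂ)
    (hx : ∀ y, ∃ r : ℂ, x * (y * youngSymmetrizer lam) = r • youngSymmetrizer lam)
    (hk : x * youngSymmetrizer lam = k • youngSymmetrizer lam) : spechtTrace lam x = k := by
  let u : spechtModule lam := ⟨youngSymmetrizer lam, Submodule.mem_span_singleton_self _⟩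
  have hu : u ≠ 0 := fun h => youngSymmetrizer_ne_zero lam (congrArg Subtype.val h)
  have hxu : x • u = k • u := Subtype.ext hk
  refine trace_eq_of_range_le_span_singleton (Algebra.lsmul ℂ ℂ (spechtModule lam) x) hu k
    (fun v => ?_) hxu
  obtain ⟨y, hy⟩ := exists_eq_mul_youngSymmetrizer v
  obtain ⟨r, hr⟩ := hx y
  refine ⟨r, Subtype.ext ?_⟩
  change x * (v : MonoidAlgebra ℂ (Equiv.Perm (Fin n))) = r • youngSymmetrizer lam
  rw [hy, hr]

theorem spechtTrace_mul_comm {n : ℕ} (lam : n.Partition)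
    (x y : MonoidAlgebra ℂ (Equiv.Perm (Fin n))) :
    spechtTrace lam (x * y) = spechtTrace lam (y * x) := by
  simp only [spechtTrace, LinearMap.comp_apply, AlgHom.toLinearMap_apply, map_mul]
  exact LinearMap.trace_mul_comm ℂ _ _

/-- The row projector is idempotent, and on the Specht module its image is the line of the Young
symmetrizer. -/
theorem spechtTrace_rowProjector {n : ℕ} (lam : n.Partition) :
    spechtTrace lam (rowProjector lam) = 1 := by
  refine spechtTrace_eq_of_mul lam _ 1 (fun y => ?_) ?_
  · obtain ⟨r, hr⟩ := exists_rowProjector_mul_mul_colProjector lam (y * rowProjector lam)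
    exact ⟨r, by rw [← hr, youngSymmetrizer]; simp only [mul_assoc]⟩
  · rw [youngSymmetrizer, ← mul_assoc, rowProjector_mul_self, one_smul]

/-- The Young symmetrizer is proportional to an idempotent, and its trace on its own left ideal is
the proportionality factor. -/
theorem exists_youngSymmetrizer_mul_self {n : ℕ} (lam : n.Partition) :
    ∃ κ : ℂ, youngSymmetrizer lam * youngSymmetrizer lam = κ • youngSymmetrizer lam ∧
      spechtTrace lam (youngSymmetrizer lam) = κ := by
  have h : ∀ y, ∃ r : ℂ, youngSymmetrizer lam * (y * youngSymmetrizer lam) =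
      r • youngSymmetrizer lam := fun y => by
    obtain ⟨r, hr⟩ := exists_rowProjector_mul_mul_colProjector lam
      (colProjector lam * y * rowProjector lam)
    exact ⟨r, by rw [← hr, youngSymmetrizer]; simp only [mul_assoc]⟩
  obtain ⟨κ, hκ⟩ := h 1
  rw [one_mul] at hκ
  exact ⟨κ, hκ, spechtTrace_eq_of_mul lam _ κ h hκ⟩

/-- Right multiplication by the Young symmetrizer maps the group algebra onto the Specht module,
where it acts as the scalar `κ`; comparing traces gives the character up to `κ`. -/
theorem mul_character {n : ℕ} (lam : n.Partition) {κ : ℂ}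
    (hκ : youngSymmetrizer lam * youngSymmetrizer lam = κ • youngSymmetrizer lam)
    (g : Equiv.Perm (Fin n)) :
    κ * (spechtRep lam).character g =
      ∑ y : Equiv.Perm (Fin n), (youngSymmetrizer lam).coeff (y⁻¹ * g⁻¹ * y) := by
  classical
  let R : MonoidAlgebra ℂ (Equiv.Perm (Fin n)) →ₗ[ℂ] spechtModule lam :=
    { toFun := fun y => ⟨y * youngSymmetrizer lam, Submodule.mem_span_singleton.2 ⟨y, rfl⟩⟩
      map_add' := fun x y => Subtype.ext (add_mul _ _ _)
      map_smul' := fun a x => Subtype.ext (smul_mul_assoc _ _ _) }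
  let J : spechtModule lam →ₗ[ℂ] MonoidAlgebra ℂ (Equiv.Perm (Fin n)) :=
    { toFun := fun v => MonoidAlgebra.of ℂ _ g * v
      map_add' := fun x y => mul_add _ _ _
      map_smul' := fun a x => mul_smul_comm _ _ _ }
  have h1 : R ∘ₗ J = κ • spechtRep lam g := by
    refine LinearMap.ext fun v => Subtype.ext ?_
    obtain ⟨y, hy⟩ := exists_eq_mul_youngSymmetrizer v
    change MonoidAlgebra.of ℂ _ g * (v : MonoidAlgebra ℂ (Equiv.Perm (Fin n))) *
      youngSymmetrizer lam = κ • (MonoidAlgebra.of ℂ _ g * (v : MonoidAlgebra ℂ _))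
    rw [hy, mul_assoc, mul_assoc y, hκ, mul_smul_comm, mul_smul_comm]
  have h2 := LinearMap.trace_comp_comm' J R
  rw [h1, map_smul, smul_eq_mul] at h2
  rw [Representation.character, h2,
    LinearMap.trace_eq_matrix_trace ℂ (MonoidAlgebra.basis (Equiv.Perm (Fin n)) ℂ), Matrix.trace]
  refine Finset.sum_congr rfl fun y _ => ?_
  rw [Matrix.diag_apply, LinearMap.toMatrix_apply]
  change (MonoidAlgebra.of ℂ _ g * (MonoidAlgebra.single y 1 * youngSymmetrizer lam)).coeff y = _
  rw [← MonoidAlgebra.of_apply, ← mul_assoc, ← map_mul, MonoidAlgebra.of_apply,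
    MonoidAlgebra.coeff_single_mul_apply, one_mul,
    mul_inv_rev]

theorem spechtTrace_eq_sum {n : ℕ} (lam : n.Partition)
    (x : MonoidAlgebra ℂ (Equiv.Perm (Fin n))) :
    spechtTrace lam x = ∑ h, x.coeff h * (spechtRep lam).character h := by
  induction x using MonoidAlgebra.induction_on with
  | of g => simp [MonoidAlgebra.of_apply, Finsupp.single_apply, character_eq_spechtTrace]
  | add f g hf hg =>
    simp [hf, hg, add_mul, Finset.sum_add_distrib]
  | smul r f hf => simp [hf, mul_assoc, Finset.mul_sum]

theorem character_conj {n : ℕ} (lam : n.Partition) (g y : Equiv.Perm (Fin n)) :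
    (spechtRep lam).character (y * g * y⁻¹) = (spechtRep lam).character g := by
  rw [mul_assoc, Representation.char_mul_comm, inv_mul_cancel_right]

theorem character_inv {n : ℕ} (lam : n.Partition) (g : Equiv.Perm (Fin n)) :
    (spechtRep lam).character g⁻¹ = (spechtRep lam).character g := by
  obtain ⟨y, hy⟩ := isConj_iff.1 (isConj_iff_cycleType_eq.2 (cycleType_inv g))
  rw [← character_conj lam g⁻¹ y, hy]

/-- The trace formula at the identity reads `κ dim V_λ = n! c_λ(1)`, which is nonzero. -/
theorem ne_zero_of_youngSymmetrizer_mul_self {n : ℕ} (lam : n.Partition) {κ : ℂ}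
    (hκ : youngSymmetrizer lam * youngSymmetrizer lam = κ • youngSymmetrizer lam) : κ ≠ 0 := by
  rintro rfl
  have h := mul_character lam hκ 1
  simp [coeff_one_youngSymmetrizer_ne_zero, Fintype.card_perm, Nat.factorial_ne_zero] at h

/-- The Specht character has norm one. -/
theorem sum_character_mul_self {n : ℕ} (lam : n.Partition) :
    ∑ g, (spechtRep lam).character g * (spechtRep lam).character g = n.factorial := by
  obtain ⟨κ, hκ, hT⟩ := exists_youngSymmetrizer_mul_self lam
  refine mul_left_cancel₀ (ne_zero_of_youngSymmetrizer_mul_self lam hκ) ?_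
  calc _ = ∑ y : Equiv.Perm (Fin n), ∑ g, (youngSymmetrizer lam).coeff (y⁻¹ * g⁻¹ * y) *
        (spechtRep lam).character g := by
        rw [Finset.sum_comm, Finset.mul_sum]
        exact Finset.sum_congr rfl fun g _ => by
          rw [← mul_assoc, mul_character lam hκ, Finset.sum_mul]
    _ = ∑ y : Equiv.Perm (Fin n), spechtTrace lam (youngSymmetrizer lam) := by
        refine Finset.sum_congr rfl fun y _ => ?_
        rw [spechtTrace_eq_sum]
        refine Fintype.sum_equiv ((Equiv.inv _).trans (MulAut.conj y⁻¹).toEquiv) _ _ fun g => ?_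
        simp only [Equiv.trans_apply, Equiv.inv_apply, MulEquiv.toEquiv_eq_coe,
          MulEquiv.coe_toEquiv, MulAut.conj_apply, inv_inv]
        rw [← character_inv lam g, ← character_conj lam g⁻¹ y⁻¹, inv_inv]
    _ = κ * n.factorial := by
        rw [hT, Finset.sum_const, Finset.card_univ, Fintype.card_perm, Fintype.card_fin,
          nsmul_eq_mul, mul_comm]

/-- The Specht character is real-valued. -/
theorem exists_real_character {n : ℕ} (lam : n.Partition) (g : Equiv.Perm (Fin n)) :
    ∃ r : ℝ, (spechtRep lam).character g = r := by
  classical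
  obtain ⟨κ, hκ, -⟩ := exists_youngSymmetrizer_mul_self lam
  have hreal : ∀ h, ∃ s : ℝ, κ * (spechtRep lam).character h = s := by
    intro h
    refine ⟨∑ y : Equiv.Perm (Fin n), ((youngSymmetrizer lam).coeff (y⁻¹ * h⁻¹ * y)).re, ?_⟩
    rw [mul_character lam hκ]
    push_cast
    refine Finset.sum_congr rfl fun y _ => (Complex.conj_eq_iff_re.1 ?_).symm
    simp [coeff_youngSymmetrizer, -Int.cast_sum]
  obtain ⟨s, hs⟩ := hreal g
  obtain ⟨t, ht⟩ := hreal 1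
  have hd : κ * (Module.finrank ℂ (spechtModule lam) : ℂ) = t := by
    rw [← ht, Representation.char_one]
  -- the value at the identity is the dimension, so the factor `κ` itself is real
  have hdim : (Module.finrank ℂ (spechtModule lam) : ℂ) ≠ 0 := by
    intro h0
    have h := mul_character lam hκ 1
    rw [Representation.char_one, h0] at h
    simp [coeff_one_youngSymmetrizer_ne_zero, Fintype.card_perm, Nat.factorial_ne_zero] at h
  refine ⟨s * Module.finrank ℂ (spechtModule lam) / t, ?_⟩
  have ht0 : (t : ℂ) ≠ 0 := by
    rw [← hd]
    exact mul_ne_zero (ne_zero_of_youngSymmetrizer_mul_self lam hκ) hdim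
  push_cast
  rw [eq_div_iff ht0, ← hs, ← hd]
  ring

/-! ### Pairing with the permutation characters -/

theorem sum_wordChar_mul_character {n N : ℕ} (lam : n.Partition) (α : Fin N →₀ ℕ) :
    ∑ g : Equiv.Perm (Fin n), (wordChar α g : ℂ) * (spechtRep lam).character g =
      ∑ w : Fin n → Fin N with content w = α, spechtTrace lam (stabSum w) := by
  simp only [wordChar, Finset.card_filter, stabSum, map_sum, Finset.sum_filter, Nat.cast_sum,
    Finset.sum_mul]
  rw [Finset.sum_comm]
  refine Finset.sum_congr rfl fun w _ => ?_
  by_cases h : content w = α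
  · simp only [h, and_true, if_true, character_eq_spechtTrace, Nat.cast_ite, Nat.cast_one,
      Nat.cast_zero, ite_mul, one_mul, zero_mul]
    exact Finset.sum_congr rfl fun g _ => by split_ifs <;> simp
  · simp [h]

theorem sum_wordChar_mul_character_eq_zero {n N : ℕ} (lam : n.Partition) (α : Fin N →₀ ℕ)
    (h : ∑ j, α j * (j : ℕ) < ∑ k, tableauRow lam k) :
    ∑ g : Equiv.Perm (Fin n), (wordChar α g : ℂ) * (spechtRep lam).character g = 0 := by
  rw [sum_wordChar_mul_character]
  refine Finset.sum_eq_zero fun w hw => ?_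
  obtain rfl := (Finset.mem_filter.1 hw).2
  have h0 : ∀ y, stabSum w * (y * youngSymmetrizer lam) = 0 := fun y => by
    rw [youngSymmetrizer, ← mul_assoc y, ← mul_assoc]
    exact stabSum_mul_mul_colProjector_eq_zero lam w h _
  refine spechtTrace_eq_of_mul lam _ 0 (fun y => ⟨0, by rw [h0, zero_smul]⟩) ?_
  rw [zero_smul, ← h0 1, one_mul]

theorem stabSum_comp {n : ℕ} {ι : Type*} [DecidableEq ι] (w : Fin n → ι)
    (e : Equiv.Perm (Fin n)) :
    stabSum (w ∘ e) = MonoidAlgebra.of ℂ _ e⁻¹ * stabSum w * MonoidAlgebra.of ℂ _ e := by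
  simp only [stabSum, Finset.mul_sum, Finset.sum_mul, ← map_mul]
  refine Finset.sum_bij' (fun g _ => e * g * e⁻¹) (fun g _ => e⁻¹ * g * e) ?_ ?_ ?_ ?_ ?_
  · intro g hg
    have hg := (Finset.mem_filter.1 hg).2
    refine Finset.mem_filter.2 ⟨Finset.mem_univ _, funext fun k => ?_⟩
    simpa using congrFun hg (e⁻¹ k)
  · intro g hg
    have hg := (Finset.mem_filter.1 hg).2
    refine Finset.mem_filter.2 ⟨Finset.mem_univ _, funext fun k => ?_⟩
    simpa using congrFun hg (e k)
  all_goals intro g _; simp [mul_assoc]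

/-- The tableau as a word: each position carries the number of its row. -/
def rowWord {n N : ℕ} (lam : n.Partition) (hN : Multiset.card lam.parts ≤ N) (k : Fin n) : Fin N :=
  ⟨tableauRow lam k, (tableauRow_lt lam k).trans_le hN⟩

theorem content_rowWord {n N : ℕ} (lam : n.Partition) (hN : Multiset.card lam.parts ≤ N)
    (j : Fin N) : content (rowWord lam hN) j = part lam j := by
  rw [content_apply, ← card_tableauRow_eq]
  congr 1
  ext k
  simp [rowWord, Fin.ext_iff]

theorem sum_wordChar_mul_character_self {n N : ℕ} (lam : n.Partition)
    (hN : Multiset.card lam.parts ≤ N) :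
    ∑ g : Equiv.Perm (Fin n), (wordChar (content (rowWord lam hN)) g : ℂ) *
      (spechtRep lam).character g = n.factorial := by
  have hfix : ∀ g : Equiv.Perm (Fin n),
      rowWord lam hN ∘ g = rowWord lam hN ↔ tableauRow lam ∘ g = tableauRow lam := fun g => by
    simp [funext_iff, rowWord]
  have h1 : stabSum (rowWord lam hN) = stabSum (tableauRow lam) := by
    simp only [stabSum, hfix]
  have h2 : stabCard (rowWord lam hN) = stabCard (tableauRow lam) := by
    simp only [stabCard, hfix]
  rw [sum_wordChar_mul_character, ← sum_stabCard (content (rowWord lam hN))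
    (by simpa using sum_content_mul (rowWord lam hN) fun _ => 1), Nat.cast_sum]
  refine Finset.sum_congr rfl fun w hw => ?_
  obtain ⟨e, rfl⟩ := exists_perm_of_content_eq (Finset.mem_filter.1 hw).2
  rw [stabSum_comp, mul_assoc, spechtTrace_mul_comm, mul_assoc, ← map_mul, mul_inv_cancel, map_one,
    mul_one, h1, ← stabCard_smul_rowProjector, map_smul, spechtTrace_rowProjector,
    stabCard_comp_perm, h2, smul_eq_mul, mul_one]

/-- By rearrangement, a nontrivial alternation of `λ + ρ` lowers `∑ j α_j`. -/
theorem sum_sub_rhoPerm_mul_lt {n N : ℕ} (lam : n.Partition) (hN : Multiset.card lam.parts ≤ N)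
    {σ : Equiv.Perm (Fin N)} (hσ : σ ≠ 1) (hle : rhoPerm σ ≤ shiftedExponent lam N) :
    ∑ j, (shiftedExponent lam N - rhoPerm σ) j * (j : ℕ) < ∑ k, tableauRow lam k := by
  have h0 : ∑ k, tableauRow lam k = ∑ j : Fin N, part lam j * (j : ℕ) := by
    simp only [← content_rowWord lam hN]
    exact (sum_content_mul (rowWord lam hN) fun j => (j : ℕ)).symm
  have h1 : ∀ j : Fin N, (((shiftedExponent lam N - rhoPerm σ) j : ℕ) : ℤ) =
      part lam j + ((σ j : ℕ) : ℤ) - ((j : ℕ) : ℤ) := by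
    intro j
    have h : N - 1 - (σ j : ℕ) ≤ part lam j + (N - 1 - (j : ℕ)) := hle j
    have h' : (shiftedExponent lam N - rhoPerm σ) j =
      part lam j + (N - 1 - (j : ℕ)) - (N - 1 - (σ j : ℕ)) := rfl
    have := j.2
    have := (σ j).2
    omega
  have h2 : ∑ j : Fin N, (((σ j : ℕ) : ℤ)) ^ 2 = ∑ j : Fin N, (((j : ℕ) : ℤ)) ^ 2 :=
    Equiv.sum_comp σ fun j : Fin N => ((j : ℕ) : ℤ) ^ 2
  have h3 : 0 < ∑ j : Fin N, (((σ j : ℕ) : ℤ) - ((j : ℕ) : ℤ)) ^ 2 := by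
    obtain ⟨j, hj⟩ : ∃ j, σ j ≠ j := by
      by_contra! h
      exact hσ (Equiv.ext h)
    refine Finset.sum_pos' (fun j _ => sq_nonneg _) ⟨j, Finset.mem_univ _, ?_⟩
    have : ((σ j : ℕ) : ℤ) - ((j : ℕ) : ℤ) ≠ 0 := by
      rw [Ne, sub_eq_zero, Nat.cast_inj, Fin.val_inj]
      exact hj
    positivity
  rw [h0, ← Nat.cast_lt (α := ℤ), Nat.cast_sum, Nat.cast_sum]
  simp only [Nat.cast_mul, h1]
  simp only [sub_sq, Finset.sum_add_distrib, Finset.sum_sub_distrib, h2] at h3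
  have h4 : ∀ j : Fin N, ((part lam j : ℤ) + ((σ j : ℕ) : ℤ) - ((j : ℕ) : ℤ)) * ((j : ℕ) : ℤ) =
      (part lam j : ℤ) * ((j : ℕ) : ℤ) + (((σ j : ℕ) : ℤ) * ((j : ℕ) : ℤ) - ((j : ℕ) : ℤ) ^ 2) :=
    fun j => by ring
  simp only [h4, Finset.sum_add_distrib, Finset.sum_sub_distrib]
  simp only [mul_assoc, ← Finset.mul_sum] at h3
  linarith

/-- Only the identity term of the alternating sum meets the Specht character. -/
theorem sum_alternantChar_mul_character {n N : ℕ} (lam : n.Partition)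
    (hN : Multiset.card lam.parts ≤ N) :
    ∑ g : Equiv.Perm (Fin n), ((alternantChar (shiftedExponent lam N) g : ℤ) : ℂ) *
      (spechtRep lam).character g = n.factorial := by
  have hone : shiftedExponent lam N - rhoPerm 1 = content (rowWord lam hN) := by
    ext j
    rw [content_rowWord]
    exact Nat.add_sub_cancel _ _
  simp only [alternantChar, Int.cast_sum, Finset.sum_mul]
  rw [Finset.sum_comm, Finset.sum_eq_single 1]
  · rw [← sum_wordChar_mul_character_self lam hN, ← hone]
    refine Finset.sum_congr rfl fun g _ => ?_
    have hle : rhoPerm 1 ≤ shiftedExponent lam N := fun j => Nat.le_add_left _ _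
    rw [if_pos hle]
    simp
  · intro σ _ hσ
    by_cases hle : rhoPerm σ ≤ shiftedExponent lam N
    · simp only [if_pos hle, Int.cast_mul, Int.cast_natCast, mul_assoc]
      rw [← Finset.mul_sum, sum_wordChar_mul_character_eq_zero lam _
        (sum_sub_rhoPerm_mul_lt lam hN hσ hle), mul_zero]
    · simp [if_neg hle]
  · simp

theorem shiftedExponent_injective {n : ℕ} (lam : n.Partition) (N : ℕ) :
    Function.Injective (shiftedExponent lam N) := by
  refine StrictAnti.injective (f := (shiftedExponent lam N : Fin N → ℕ)) fun i j hij => ?_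
  have h1 := part_antitone lam (show (i : ℕ) ≤ j from hij.le)
  have h2 : (i : ℕ) < j := hij
  have := j.2
  change part lam j + (N - 1 - (j : ℕ)) < part lam i + (N - 1 - (i : ℕ))
  omega

theorem sum_shiftedExponent {n N : ℕ} (lam : n.Partition) (hN : Multiset.card lam.parts ≤ N) :
    ∑ j, shiftedExponent lam N j = n + ∑ j : Fin N, (N - 1 - (j : ℕ)) := by
  have h : ∑ j : Fin N, part lam j = n := by
    simp only [← content_rowWord lam hN]
    simpa using sum_content_mul (rowWord lam hN) fun _ => 1
  conv_rhs => rw [← h]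
  exact Finset.sum_add_distrib

/-- Two real class functions of norm one with inner product one coincide. -/
theorem character_eq_alternantChar {n N : ℕ} (lam : n.Partition)
    (hN : Multiset.card lam.parts ≤ N) (g : Equiv.Perm (Fin n)) :
    (spechtRep lam).character g = (alternantChar (shiftedExponent lam N) g : ℤ) := by
  choose χ hχ using exists_real_character lam
  have h1 := sum_alternantChar_mul_self (n := n) (shiftedExponent lam N)
    (shiftedExponent_injective lam N) (sum_shiftedExponent lam hN)
  have h2 := sum_alternantChar_mul_character lam hN
  have h3 := sum_character_mul_self lam
  simp only [hχ] at h2 h3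
  have h1' : ∑ g : Equiv.Perm (Fin n), (alternantChar (shiftedExponent lam N) g : ℝ) *
      alternantChar (shiftedExponent lam N) g = n.factorial := by exact_mod_cast h1
  have h2' : ∑ g : Equiv.Perm (Fin n), (alternantChar (shiftedExponent lam N) g : ℝ) * χ g =
      n.factorial := by exact_mod_cast h2
  have h3' : ∑ g : Equiv.Perm (Fin n), χ g * χ g = n.factorial := by exact_mod_cast h3
  have hsum : ∑ g : Equiv.Perm (Fin n),
      (χ g - alternantChar (shiftedExponent lam N) g) ^ 2 = 0 := by
    calc _ = ∑ g : Equiv.Perm (Fin n), (χ g * χ g -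
          2 * ((alternantChar (shiftedExponent lam N) g : ℝ) * χ g) +
          (alternantChar (shiftedExponent lam N) g : ℝ) *
            alternantChar (shiftedExponent lam N) g) :=
          Finset.sum_congr rfl fun g _ => by ring
      _ = 0 := by
          rw [Finset.sum_add_distrib, Finset.sum_sub_distrib, ← Finset.mul_sum, h1', h2', h3']
          ring
  have := (Finset.sum_eq_zero_iff_of_nonneg fun g _ => sq_nonneg _).1 hsum g (Finset.mem_univ g)
  rw [hχ, sub_eq_zero.1 (pow_eq_zero_iff two_ne_zero |>.1 this)]
  norm_cast

end FrobeniusFormula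

theorem mainTheorem7 (n : ℕ) (lam : n.Partition) (N : ℕ) (hN : Multiset.card lam.parts ≤ N)
    (i : ℕ → ℕ) (g : Equiv.Perm (Fin n))
    (hg : ∀ m : ℕ, 1 ≤ m → g.partition.parts.count m = i m) :
    (FrobeniusFormula.spechtRep lam).character g =
      MvPolynomial.coeff (FrobeniusFormula.shiftedExponent lam N)
        (FrobeniusFormula.deltaPoly N *
          ∏ m ∈ Finset.Icc 1 n, MvPolynomial.psum (Fin N) ℂ m ^ i m) := by
  rw [FrobeniusFormula.prod_psum_pow i g hg, FrobeniusFormula.character_eq_alternantChar lam hN,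
    ← FrobeniusFormula.coeff_deltaPoly_mul_fixedWords, FrobeniusFormula.fixedWords]
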